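/- A skew brace $(A,\cdot,\circ)$ is a set $A$ with two group structures $(A,\cdot)$ and $(A,\circ)$ such that $a\circ(b\cdot c)=(a\circ b)\cdot a^{-1}\cdot(a\circ c)$ for all $a,b,c\in A$, where $a^{-1}$ is the inverse of $a$ in $(A,\cdot)$. It is a bi-skew brace if $(A,\circ,\cdot)$ is also a skew brace. By a solution $(X,r)$ we mean a set $X$ with a bijection $r\colon X^2\to X^2$, $r(x,y)=(\sigma_x(y),\tau_y(x))$, that satisfies the braid equation $r_1r_2r_1=r_2r_1r_2$ on $X^3$, where $r_1=r\times\mathrm{id}_X$ and $r_2=\mathrm{id}_X\times r$, and is non-degenerate: all maps $\sigma_x,\tau_x\colon X\to X$ are bijective. Then $(X,r^{-1})$ is also a solution, and we write $r^{-1}(x,y)=(\hat\sigma_x(y),\hat\tau_y(x))$. The structure skew brace $(G(X,r),\cdot,\circ)$ of a solution has as multiplicative group the structure group $$(G(X,r),\circ)=\langle X\mid x\circ y=\sigma_x(y)\circ\tau_y(x)\ \text{for all } x,y\in X\rangle .$$ Its additive group is obtained from the derived structure group $$A(X,r)=\langle X\mid x\cdot y=y\cdot\sigma_y\hat\sigma_y^{-1}(x)\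 \text{for all } x,y\in X\rangle$$ by transport along the canonical bijection $\pi\colon G(X,r)\to A(X,r)$. Here $\pi$ is the unique map that sends each generator $x$ to the generator $x$ and satisfies $\pi(g\circ h)=\pi(g)\cdot\lambda_g(\pi(h))$ for all $g,h\in G(X,r)$, where $\lambda$ is the action of $(G(X,r),\circ)$ on $A(X,r)$ by automorphisms determined by $\lambda_x(y)=\sigma_x(y)$ for $x,y\in X$. Let $\iota\colon X\to G(X,r)$ be the canonical map that sends each element to its generator. The solution is called injective if $\iota$ is injective. **Theorem.** Let $(X,r)$ be a solution. 1. If $(X,r)$ is injective, then $G(X,r)$ is a bi-skew brace if and only if $\sigma_{\hat\sigma_x(y)}=\sigma_y$ for all $x,y\in X$. 2. For every solution $(X,r)$, injective or not: if $\sigma_{\hat\sigma_x(y)}=\sigma_y$ for all $x,y\in X$, then $G(X,r)$ is a bi-skew brace. -/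

import Mathlib

/-- The left brace equation `a ∘ (b · c) = (a ∘ b) · a⁻¹ · (a ∘ c)` for two group structures
`dot` and `circ` on the same set; `a⁻¹` is the inverse with respect to `dot`. -/
def LeftBraceEquation {A : Type*} (dot circ : Group A) : Prop :=
  ∀ a b c : A,
    circ.mul a (dot.mul b c) = dot.mul (dot.mul (circ.mul a b) (dot.inv a)) (circ.mul a c)

/-- A skew (left) brace structure `(A, ·, ∘)` on a set `A`. -/
structure SkewBrace (A : Type*) where
  /-- the additive group `(A, ·)` -/
  dot : Group A
  /-- the multiplicative group `(A, ∘)` -/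
  circ : Group A
  left_brace : LeftBraceEquation dot circ

/-- `(A, ·, ∘)` is a bi-skew brace if `(A, ∘, ·)` is a skew brace as well. -/
def SkewBrace.IsBiSkew {A : Type*} (B : SkewBrace A) : Prop :=
  LeftBraceEquation B.circ B.dot

/-- `r × id` as a self-map of `X × X × X`. -/
def actFirstTwo {X : Type*} (r : X × X → X × X) (p : X × X × X) : X × X × X :=
  ((r (p.1, p.2.1)).1, (r (p.1, p.2.1)).2, p.2.2)

/-- `id × r` as a self-map of `X × X × X`. -/
def actLastTwo {X : Type*} (r : X × X → X × X) (p : X × X × X) : X × X × X :=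
  (p.1, r p.2)

/-- A (bijective) non-degenerate solution of the set-theoretic Yang–Baxter equation on `X`.
Writing `r (x, y) = (σ_x y, τ_y x)`, all the maps `σ_x` and `τ_y` are bijective. -/
structure YBSolution (X : Type*) where
  r : X × X ≃ X × X
  braid : ∀ p : X × X × X,
    actFirstTwo r (actLastTwo r (actFirstTwo r p)) = actLastTwo r (actFirstTwo r (actLastTwo r p))
  sigma_bijective : ∀ x : X, Function.Bijective fun y : X => (r (x, y)).1
  tau_bijective : ∀ y : X, Function.Bijective fun x : X => (r (x, y)).2

namespace YBSolution

variable {X : Type*} (S : YBSolution X)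

/-- `σ_x`, as a permutation of `X`. -/
noncomputable def sigma (x : X) : Equiv.Perm X :=
  Equiv.ofBijective (fun y => (S.r (x, y)).1) (S.sigma_bijective x)

/-- `τ_y`, as a permutation of `X`. -/
noncomputable def tau (y : X) : Equiv.Perm X :=
  Equiv.ofBijective (fun x => (S.r (x, y)).2) (S.tau_bijective y)

theorem r_apply (x y : X) : S.r (x, y) = (S.sigma x y, S.tau y x) := rfl

theorem sigma_sigma (x y z : X) :
    S.sigma x (S.sigma y z) = S.sigma (S.sigma x y) (S.sigma (S.tau y x) z) :=
  (congrArg (fun p : X × X × X => p.1) (S.braid (x, y, z))).symm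

theorem tau_sigma (x y z : X) :
    S.tau (S.sigma (S.tau y x) z) (S.sigma x y) = S.sigma (S.tau (S.sigma y z) x) (S.tau z y) :=
  congrArg (fun p : X × X × X => p.2.1) (S.braid (x, y, z))

theorem tau_tau (x y z : X) :
    S.tau z (S.tau y x) = S.tau (S.tau z y) (S.tau (S.sigma y z) x) :=
  congrArg (fun p : X × X × X => p.2.2) (S.braid (x, y, z))

/-- The inverse solution `(X, r⁻¹)`. -/
def inverse : YBSolution X where
  r := S.r.symm
  braid := by
    have h1 : ∀ p, actFirstTwo S.r (actFirstTwo S.r.symm p) = p := by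
      rintro ⟨x, y, z⟩; simp [actFirstTwo]
    have h1' : ∀ p, actFirstTwo S.r.symm (actFirstTwo S.r p) = p := by
      rintro ⟨x, y, z⟩; simp [actFirstTwo]
    have h2 : ∀ p, actLastTwo S.r (actLastTwo S.r.symm p) = p := by
      rintro ⟨x, y, z⟩; simp [actLastTwo]
    have h2' : ∀ p, actLastTwo S.r.symm (actLastTwo S.r p) = p := by
      rintro ⟨x, y, z⟩; simp [actLastTwo]
    intro p
    have h := S.braid (actFirstTwo S.r.symm (actLastTwo S.r.symm (actFirstTwo S.r.symm p)))
    rw [h1, h2, h1] at h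
    nth_rewrite 2 [h]
    rw [h2', h1', h2']
  sigma_bijective := by
    intro u
    refine Function.bijective_iff_has_inverse.2
      ⟨fun x => S.tau ((S.sigma x).symm u) x, fun v => ?_, fun x => ?_⟩
    · obtain ⟨⟨x, y⟩, h⟩ := S.r.surjective (u, v)
      have h' := h
      rw [r_apply, Prod.mk.injEq] at h'
      have hs : S.r.symm (u, v) = (x, y) := by rw [← h, Equiv.symm_apply_apply]
      simp only [hs]
      rw [← h'.1, Equiv.symm_apply_apply, h'.2]
    · have h : S.r (x, (S.sigma x).symm u) = (u, S.tau ((S.sigma x).symm u) x) := by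
        simp [r_apply]
      simp [← h]
  tau_bijective := by
    intro v
    refine Function.bijective_iff_has_inverse.2
      ⟨fun y => S.sigma ((S.tau y).symm v) y, fun u => ?_, fun y => ?_⟩
    · obtain ⟨⟨x, y⟩, h⟩ := S.r.surjective (u, v)
      have h' := h
      rw [r_apply, Prod.mk.injEq] at h'
      have hs : S.r.symm (u, v) = (x, y) := by rw [← h, Equiv.symm_apply_apply]
      simp only [hs]
      rw [← h'.2, Equiv.symm_apply_apply, h'.1]
    · have h : S.r ((S.tau y).symm v, y) = (S.sigma ((S.tau y).symm v) y, v) := by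
        simp [r_apply]
      simp [← h]

/-- `σ̂_x`, where `r⁻¹ (x, y) = (σ̂_x y, τ̂_y x)`. -/
noncomputable def sigmaHat (x : X) : Equiv.Perm X := S.inverse.sigma x

/-- `τ̂_y`, where `r⁻¹ (x, y) = (σ̂_x y, τ̂_y x)`. -/
noncomputable def tauHat (y : X) : Equiv.Perm X := S.inverse.tau y

theorem r_symm_apply (x y : X) : S.r.symm (x, y) = (S.sigmaHat x y, S.tauHat y x) := rfl

theorem sigmaHat_tau (x y : X) : S.sigmaHat (S.sigma x y) (S.tau y x) = x := by
  have h := S.r_symm_apply (S.sigma x y) (S.tau y x)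
  rw [← r_apply, Equiv.symm_apply_apply, Prod.mk.injEq] at h
  exact h.1.symm

theorem tauHat_sigma (x y : X) : S.tauHat (S.tau y x) (S.sigma x y) = y := by
  have h := S.r_symm_apply (S.sigma x y) (S.tau y x)
  rw [← r_apply, Equiv.symm_apply_apply, Prod.mk.injEq] at h
  exact h.2.symm

/-- Defining relations `x ∘ y = σ_x(y) ∘ τ_y(x)` of the structure group. -/
def structureRels : Set (FreeGroup X) :=
  {w | ∃ x y : X, w = FreeGroup.of x * FreeGroup.of y *
    (FreeGroup.of (S.sigma x y) * FreeGroup.of (S.tau y x))⁻¹}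

/-- The structure group `G(X, r)`, with group operation `∘`. -/
abbrev StructureGroup : Type _ := PresentedGroup S.structureRels

/-- The canonical map `ι : X → G(X, r)`. -/
def iota (x : X) : S.StructureGroup := PresentedGroup.of x

/-- The solution is injective if `ι : X → G(X, r)` is injective. -/
def IsInjective : Prop := Function.Injective S.iota

/-- Defining relations `x · y = y · σ_y(σ̂_y⁻¹(x))` of the derived structure group. -/
def derivedRels : Set (FreeGroup X) :=
  {w | ∃ x y : X, w = FreeGroup.of x * FreeGroup.of y *
    (FreeGroup.of y * FreeGroup.of (S.sigma y ((S.sigmaHat y).symm x)))⁻¹}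

/-- The derived structure group `A(X, r)`, with group operation `·`. -/
abbrev DerivedGroup : Type _ := PresentedGroup S.derivedRels

/-- The canonical map `X → A(X, r)`. -/
def iotaDerived (x : X) : S.DerivedGroup := PresentedGroup.of x

theorem iota_mul (x y : X) :
    S.iota x * S.iota y = S.iota (S.sigma x y) * S.iota (S.tau y x) := by
  have h : (PresentedGroup.mk S.structureRels) (FreeGroup.of x * FreeGroup.of y *
    (FreeGroup.of (S.sigma x y) * FreeGroup.of (S.tau y x))⁻¹) = 1 :=
    PresentedGroup.one_of_mem ⟨x, y, rfl⟩
  rw [map_mul, map_inv, mul_inv_eq_one, map_mul, map_mul] at h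
  exact h

theorem iotaDerived_mul (x y : X) : S.iotaDerived x * S.iotaDerived y =
    S.iotaDerived y * S.iotaDerived (S.sigma y ((S.sigmaHat y).symm x)) := by
  have h : (PresentedGroup.mk S.derivedRels) (FreeGroup.of x * FreeGroup.of y *
    (FreeGroup.of y * FreeGroup.of (S.sigma y ((S.sigmaHat y).symm x)))⁻¹) = 1 :=
    PresentedGroup.one_of_mem ⟨x, y, rfl⟩
  rw [map_mul, map_inv, mul_inv_eq_one, map_mul, map_mul] at h
  exact h

theorem sigmaHat_symm (x y : X) : (S.sigmaHat (S.sigma x y)).symm x = S.tau y x := by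
  rw [Equiv.symm_apply_eq, sigmaHat_tau]

theorem sigma_derived (z x u : X) : S.sigma z (S.sigma u ((S.sigmaHat u).symm x)) =
    S.sigma (S.sigma z u) ((S.sigmaHat (S.sigma z u)).symm (S.sigma z x)) := by
  obtain ⟨y, rfl⟩ := (S.sigma x).surjective u
  rw [sigmaHat_symm, S.sigma_sigma z x y, sigmaHat_symm, tau_sigma, ← S.sigma_sigma z x y,
    ← sigma_sigma]

theorem sigma_symm_derived (z x u : X) :
    (S.sigma z).symm (S.sigma u ((S.sigmaHat u).symm x)) =
    S.sigma ((S.sigma z).symm u)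
      ((S.sigmaHat ((S.sigma z).symm u)).symm ((S.sigma z).symm x)) := by
  rw [Equiv.symm_apply_eq, sigma_derived]
  simp

/-- The automorphism of `A(X, r)` that sends the generator of `y` to that of `σ_x y`. -/
noncomputable def derivedAut (x : X) : MulAut S.DerivedGroup :=
  MonoidHom.toMulEquiv
    (PresentedGroup.toGroup (f := fun y => S.iotaDerived (S.sigma x y)) (by
      rintro _ ⟨y, z, rfl⟩
      simp only [map_mul, map_inv, FreeGroup.lift_apply_of, mul_inv_eq_one]
      rw [iotaDerived_mul, ← sigma_derived]))
    (PresentedGroup.toGroup (f := fun y => S.iotaDerived ((S.sigma x).symm y)) (by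
      rintro _ ⟨y, z, rfl⟩
      simp only [map_mul, map_inv, FreeGroup.lift_apply_of, mul_inv_eq_one]
      rw [iotaDerived_mul, ← sigma_symm_derived]))
    (by ext y; simp [iotaDerived])
    (by ext y; simp [iotaDerived])

@[simp]
theorem derivedAut_iotaDerived (x y : X) :
    S.derivedAut x (S.iotaDerived y) = S.iotaDerived (S.sigma x y) := by
  simp [derivedAut, iotaDerived]

theorem derivedAut_mul (x y : X) : S.derivedAut x * S.derivedAut y =
    S.derivedAut (S.sigma x y) * S.derivedAut (S.tau y x) := by
  have h : (S.derivedAut x * S.derivedAut y).toMonoidHom =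
      (S.derivedAut (S.sigma x y) * S.derivedAut (S.tau y x)).toMonoidHom := by
    refine PresentedGroup.ext fun z => ?_
    change S.derivedAut x (S.derivedAut y (S.iotaDerived z)) =
      S.derivedAut (S.sigma x y) (S.derivedAut (S.tau y x) (S.iotaDerived z))
    simp only [derivedAut_iotaDerived]
    rw [sigma_sigma]
  exact MulEquiv.ext fun a => DFunLike.congr_fun h a

/-- The homomorphism from `G(X, r)` to the holomorph of `A(X, r)` that sends the generator of `x`
to the pair consisting of the generator of `x` and the automorphism induced by `σ_x`. -/
noncomputable def toHolomorph :
    S.StructureGroup →* S.DerivedGroup ⋊[MonoidHom.id (MulAut S.DerivedGroup)]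
      MulAut S.DerivedGroup :=
  PresentedGroup.toGroup (f := fun x => ⟨S.iotaDerived x, S.derivedAut x⟩) (by
    rintro _ ⟨x, y, rfl⟩
    simp only [map_mul, map_inv, FreeGroup.lift_apply_of, mul_inv_eq_one]
    refine SemidirectProduct.ext ?_ ?_
    · simp only [SemidirectProduct.mul_left, MonoidHom.id_apply, derivedAut_iotaDerived]
      rw [iotaDerived_mul, sigmaHat_symm]
    · exact S.derivedAut_mul x y)

/-- The canonical action of `(G(X, r), ∘)` on `A(X, r)`; the generator of `x` acts by `σ_x` on
generators. -/
noncomputable def action (g : S.StructureGroup) : MulAut S.DerivedGroup := (S.toHolomorph g).right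

/-- The canonical map `G(X, r) → A(X, r)`: the `1`-cocycle for the canonical action that sends
each generator to the generator with the same name. -/
noncomputable def cocycle (g : S.StructureGroup) : S.DerivedGroup := (S.toHolomorph g).left

theorem cocycle_mul (g h : S.StructureGroup) :
    S.cocycle (g * h) = S.cocycle g * S.action g (S.cocycle h) := by
  simp [cocycle, action]

theorem action_mul (g h : S.StructureGroup) (a : S.DerivedGroup) :
    S.action (g * h) a = S.action g (S.action h a) := by
  simp [action]

theorem toHolomorph_iota (x : X) :
    S.toHolomorph (S.iota x) = ⟨S.iotaDerived x, S.derivedAut x⟩ := by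
  simp [toHolomorph, iota]

theorem cocycle_iota (x : X) : S.cocycle (S.iota x) = S.iotaDerived x := by
  simp [cocycle, toHolomorph_iota]

theorem action_iota (x y : X) :
    S.action (S.iota x) (S.iotaDerived y) = S.iotaDerived (S.sigma x y) := by
  simp [action, toHolomorph_iota]

/-- The action of `G(X, r)` on `X` in which the generator of `x` acts by `σ_x`. -/
noncomputable def perm : S.StructureGroup →* Equiv.Perm X :=
  PresentedGroup.toGroup (f := S.sigma) (by
    rintro _ ⟨x, y, rfl⟩
    simp only [map_mul, map_inv, FreeGroup.lift_apply_of, mul_inv_eq_one]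
    ext z
    exact S.sigma_sigma x y z)

theorem perm_iota (x : X) : S.perm (S.iota x) = S.sigma x := by
  simp [perm, iota]

theorem structure_induction {p : S.StructureGroup → Prop} (one : p 1)
    (mul : ∀ g x, p g → p (g * S.iota x)) (inv : ∀ g x, p g → p (g * (S.iota x)⁻¹)) :
    ∀ g, p g := by
  intro g
  have hg : g ∈ Subgroup.closure (Set.range S.iota) := by
    have h : Subgroup.closure (Set.range S.iota) = ⊤ :=
      PresentedGroup.closure_range_of S.structureRels
    rw [h]; trivial
  induction hg using Subgroup.closure_induction_right with
  | one => exact one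
  | mul_right g y _ hy ih => obtain ⟨x, rfl⟩ := hy; exact mul _ _ ih
  | mul_inv_cancel g y _ hy ih => obtain ⟨x, rfl⟩ := hy; exact inv _ _ ih

theorem action_iotaDerived (g : S.StructureGroup) (y : X) :
    S.action g (S.iotaDerived y) = S.iotaDerived (S.perm g y) := by
  revert y
  refine S.structure_induction (p := fun g => ∀ y, S.action g (S.iotaDerived y) =
    S.iotaDerived (S.perm g y)) (fun y => by simp [action]) (fun g x ih y => ?_)
    (fun g x ih y => ?_) g
  · rw [action_mul, action_iota, ih, map_mul, perm_iota]; rfl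
  · have h : S.iotaDerived y = S.action (S.iota x) (S.iotaDerived ((S.sigma x).symm y)) := by
      rw [action_iota, Equiv.apply_symm_apply]
    rw [h, ← action_mul, inv_mul_cancel_right, ih, map_mul, map_inv, perm_iota]
    rfl

theorem perm_derived (g : S.StructureGroup) : ∀ x u : X,
    S.perm g (S.sigma u ((S.sigmaHat u).symm x)) =
      S.sigma (S.perm g u) ((S.sigmaHat (S.perm g u)).symm (S.perm g x)) := by
  refine S.structure_induction (p := fun g => ∀ x u : X,
    S.perm g (S.sigma u ((S.sigmaHat u).symm x)) =
      S.sigma (S.perm g u) ((S.sigmaHat (S.perm g u)).symm (S.perm g x)))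
    (fun x u => by simp) (fun g z ih x u => ?_) (fun g z ih x u => ?_) g
  · simp only [map_mul, perm_iota, Equiv.Perm.mul_apply]
    rw [sigma_derived, ih]
  · simp only [map_mul, map_inv, perm_iota, Equiv.Perm.mul_apply]
    change S.perm g ((S.sigma z).symm _) = _
    rw [sigma_symm_derived, ih]
    rfl

/-- The map `x ↦ σ_x⁻¹(x)` is a bijection with inverse `y ↦ τ̂_y⁻¹(y)`. -/
theorem sigma_eq_self_iff (w y : X) : S.sigma w y = w ↔ (S.tauHat y).symm y = w := by
  constructor
  · intro h
    have h1 : S.tauHat (S.tau y w) w = y := by simpa only [h] using S.tauHat_sigma w y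
    have h2 : S.sigmaHat w (S.tau y w) = w := by simpa only [h] using S.sigmaHat_tau w y
    have h3 : ∀ z, S.tauHat (S.tau y w) z = S.tauHat y z := by
      intro z
      obtain ⟨z, rfl⟩ := (S.tauHat w).surjective z
      have h4 := S.inverse.tau_tau z w (S.tau y w)
      change S.tauHat (S.tau y w) (S.tauHat w z) = S.tauHat (S.tauHat (S.tau y w) w)
        (S.tauHat (S.sigmaHat w (S.tau y w)) z) at h4
      rw [h1, h2] at h4
      exact h4
    rw [Equiv.symm_apply_eq, ← h3, h1]
  · intro h
    obtain ⟨x, hx⟩ := (S.tau y).surjective y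
    have h1 : S.sigma x y = w := by
      rw [← h, Equiv.eq_symm_apply]
      simpa only [hx] using S.tauHat_sigma x y
    obtain ⟨z, hz⟩ := (S.sigma y).surjective y
    have h2 := S.sigma_sigma x y z
    rw [h1, hx, hz, h1] at h2
    exact h2.symm

/-- Right multiplication by the generator of `x` in `(G(X, r), ·)`, i.e.
`g ↦ g ∘ ι(σ_g⁻¹(x))`. -/
noncomputable def rightMul (x : X) : Equiv.Perm S.StructureGroup where
  toFun g := g * S.iota ((S.perm g).symm x)
  invFun g := g * (S.iota ((S.tauHat ((S.perm g).symm x)).symm ((S.perm g).symm x)))⁻¹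
  left_inv g := by
    have h : (S.tauHat ((S.perm (g * S.iota ((S.perm g).symm x))).symm x)).symm
        ((S.perm (g * S.iota ((S.perm g).symm x))).symm x) = (S.perm g).symm x := by
      rw [← sigma_eq_self_iff, map_mul, perm_iota]
      exact Equiv.apply_symm_apply _ _
    simp only [h, mul_inv_cancel_right]
  right_inv g := by
    have key : ∀ y w : X, y = (S.perm g).symm x → (S.tauHat y).symm y = w →
        (S.perm (g * (S.iota w)⁻¹)).symm x = w := by
      intro y w hy hw
      rw [map_mul, map_inv, perm_iota]
      change S.sigma w ((S.perm g).symm x) = w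
      rw [← hy]
      exact (S.sigma_eq_self_iff w y).2 hw
    simp only [key _ _ rfl rfl, inv_mul_cancel_right]

theorem rightMul_apply (x : X) (g : S.StructureGroup) :
    S.rightMul x g = g * S.iota ((S.perm g).symm x) := rfl

theorem rightMul_rightMul (x y : X) (g : S.StructureGroup) :
    S.rightMul y (S.rightMul x g) =
      S.rightMul (S.sigma y ((S.sigmaHat y).symm x)) (S.rightMul y g) := by
  obtain ⟨a, rfl⟩ := (S.perm g).surjective x
  obtain ⟨b, rfl⟩ := (S.perm g).surjective y
  obtain ⟨c, rfl⟩ := (S.sigma a).surjective b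
  rw [← perm_derived]
  simp only [rightMul_apply, map_mul, perm_iota, Equiv.symm_apply_apply, sigmaHat_symm]
  have h : ∀ (e f : Equiv.Perm X) (z : X), (e * f).symm (e (f z)) = z :=
    fun e f z => (e * f).symm_apply_apply z
  rw [h, h, mul_assoc, mul_assoc, iota_mul]

/-- The right regular action of `A(X, r)` transported to `G(X, r)`. -/
noncomputable def rightAction : S.DerivedGroup →* (Equiv.Perm S.StructureGroup)ᵐᵒᵖ :=
  PresentedGroup.toGroup (f := fun x => MulOpposite.op (S.rightMul x)) (by
    rintro _ ⟨x, y, rfl⟩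
    simp only [map_mul, map_inv, FreeGroup.lift_apply_of, mul_inv_eq_one]
    rw [← MulOpposite.op_mul, ← MulOpposite.op_mul]
    congr 1
    ext g
    exact S.rightMul_rightMul x y g)

theorem rightAction_iotaDerived (x : X) :
    S.rightAction (S.iotaDerived x) = MulOpposite.op (S.rightMul x) := by
  simp [rightAction, iotaDerived]

theorem cocycle_rightMul (x : X) (g : S.StructureGroup) :
    S.cocycle (S.rightMul x g) = S.cocycle g * S.iotaDerived x := by
  rw [rightMul_apply, cocycle_mul, cocycle_iota, action_iotaDerived, Equiv.apply_symm_apply]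

theorem cocycle_rightAction (a : S.DerivedGroup) : ∀ g : S.StructureGroup,
    S.cocycle ((S.rightAction a).unop g) = S.cocycle g * a := by
  have ha : a ∈ Subgroup.closure (Set.range S.iotaDerived) := by
    have h : Subgroup.closure (Set.range S.iotaDerived) = ⊤ :=
      PresentedGroup.closure_range_of S.derivedRels
    rw [h]; trivial
  induction ha using Subgroup.closure_induction with
  | mem a ha =>
    obtain ⟨x, rfl⟩ := ha
    intro g
    rw [rightAction_iotaDerived]
    exact S.cocycle_rightMul x g
  | one => intro g; simp
  | mul a b _ _ iha ihb =>
    intro g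
    rw [map_mul, MulOpposite.unop_mul, Equiv.Perm.mul_apply, ihb, iha, mul_assoc]
  | inv a _ ih =>
    intro g
    rw [eq_mul_inv_iff_mul_eq, ← ih, map_inv, MulOpposite.unop_inv]
    congr 1
    exact Equiv.apply_symm_apply _ _

theorem rightAction_cocycle (g : S.StructureGroup) :
    (S.rightAction (S.cocycle g)).unop 1 = g := by
  have key : ∀ (g : S.StructureGroup) (x : X), (S.rightAction (S.cocycle (g * S.iota x))).unop 1 =
      S.rightMul (S.perm g x) ((S.rightAction (S.cocycle g)).unop 1) := by
    intro g x
    rw [cocycle_mul, cocycle_iota, action_iotaDerived, map_mul, rightAction_iotaDerived]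
    rfl
  have key' : ∀ (g : S.StructureGroup) (x : X), g * S.iota x = S.rightMul (S.perm g x) g := by
    intro g x
    rw [rightMul_apply, Equiv.symm_apply_apply]
  refine S.structure_induction (p := fun g => (S.rightAction (S.cocycle g)).unop 1 = g)
    (by simp [cocycle]) (fun g x ih => ?_) (fun g x ih => ?_) g
  · rw [key, ih, ← key']
  · have h := key (g * (S.iota x)⁻¹) x
    rw [inv_mul_cancel_right, ih] at h
    have h' := key' (g * (S.iota x)⁻¹) x
    rw [inv_mul_cancel_right] at h'
    exact ((S.rightMul _).injective (h'.symm.trans h)).symm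

theorem cocycle_bijective : Function.Bijective S.cocycle := by
  refine Function.bijective_iff_has_inverse.2
    ⟨fun a => (S.rightAction a).unop 1, S.rightAction_cocycle, fun a => ?_⟩
  rw [cocycle_rightAction]
  simp [cocycle]

/-- The canonical bijection between the sets `G(X, r)` and `A(X, r)`. -/
noncomputable def cocycleEquiv : S.StructureGroup ≃ S.DerivedGroup :=
  Equiv.ofBijective S.cocycle S.cocycle_bijective

/-- The structure skew brace `(G(X, r), ·, ∘)`: the multiplicative group is the structure group,
the additive group is the derived structure group transferred along the canonical bijection. -/
noncomputable def structureSkewBrace : SkewBrace S.StructureGroup where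
  dot := S.cocycleEquiv.group
  circ := inferInstance
  left_brace := by
    intro a b c
    have hmul : ∀ g h : S.StructureGroup, S.cocycle (S.cocycleEquiv.group.mul g h) =
        S.cocycle g * S.cocycle h := fun g h => S.cocycleEquiv.apply_symm_apply _
    have hinv : ∀ g : S.StructureGroup, S.cocycle (S.cocycleEquiv.group.inv g) =
        (S.cocycle g)⁻¹ := fun g => S.cocycleEquiv.apply_symm_apply _
    apply S.cocycle_bijective.1
    change S.cocycle (a * _) = _
    rw [cocycle_mul, hmul, hmul, hmul, hinv, map_mul]
    change _ = S.cocycle (a * b) * _ * S.cocycle (a * c)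
    rw [cocycle_mul, cocycle_mul]
    group

end YBSolution

/-!
Write `π : G(X, r) → A(X, r)` for the canonical bijection `cocycle` and `λ` for `action`. Since
`a · b = a ∘ λ_a⁻¹(b)`, the brace equation with the two operations exchanged says that every `λ_a`
is multiplicative for `∘` as well, and this amounts to `λ` being an antihomomorphism on the additive
group: `λ_{a · b} = λ_b λ_a` (`structureSkewBrace_isBiSkew_iff`).

On the side of the solution, the braid equation turns the condition `σ_{σ̂_x(y)} = σ_y` into
`σ_{σ_x(y)} σ_x = σ_x σ_y` (`sigma_sigmaHat_eq_iff`). This identity is precisely the antihomomorphism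
property for `a = ι(x)` and `b = ι(σ_x(y))`, whose additive product is `ι(x) ∘ ι(y)`, evaluated on
generators; it can be read off in `X` when `ι` is injective. Conversely, under this identity
`x ↦ σ_x` respects the relations of `A(X, r)` up to reversing products, hence extends to an
antihomomorphism `A(X, r) → Sym(X)` (`derivedPerm`). Its composite with `π` is the permutation action
of `G(X, r)` on `X` (`derivedPerm_cocycle`), which determines `λ`; so `λ` is an antihomomorphism.
-/

namespace YBSolution

variable {X : Type*} (S : YBSolution X)

/-- `G(X, r)` is a bi-skew brace exactly when `λ_{a · b} = λ_b λ_a`; here `u` stands for `a · b`. -/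
theorem structureSkewBrace_isBiSkew_iff : S.structureSkewBrace.IsBiSkew ↔
    ∀ a b u : S.StructureGroup, S.cocycle u = S.cocycle a * S.cocycle b →
      ∀ t, S.action u t = S.action b (S.action a t) := by
  have hdot : ∀ g h : S.StructureGroup, S.cocycle (S.structureSkewBrace.dot.mul g h) =
      S.cocycle g * S.cocycle h := fun g h => S.cocycleEquiv.apply_symm_apply _
  -- Write `c` as `λ_a(v)`, so that `a⁻¹ ∘ (a · c) = v` and the exchanged brace equation reads
  -- `λ_b(λ_a(v)) = λ_{a · b}(v)`.
  have key : ∀ a b c v : S.StructureGroup, S.cocycle c = S.action a (S.cocycle v) →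
      (S.structureSkewBrace.dot.mul a (b * c) = S.structureSkewBrace.dot.mul a b * a⁻¹ *
        S.structureSkewBrace.dot.mul a c ↔
      S.action b (S.action a (S.cocycle v)) =
        S.action (S.structureSkewBrace.dot.mul a b) (S.cocycle v)) := by
    intro a b c v hc
    have hac : S.structureSkewBrace.dot.mul a c = a * v := by
      apply S.cocycle_bijective.1
      rw [hdot, cocycle_mul, hc]
    rw [hac, mul_assoc _ a⁻¹, inv_mul_cancel_left, ← S.cocycle_bijective.1.eq_iff, hdot,
      cocycle_mul, cocycle_mul, hdot, hc, mul_assoc, mul_right_inj, mul_right_inj]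
  constructor
  · intro h a b u hu t
    obtain ⟨v, rfl⟩ := S.cocycle_bijective.2 t
    obtain ⟨c, hc⟩ := S.cocycle_bijective.2 (S.action a (S.cocycle v))
    have hu' : u = S.structureSkewBrace.dot.mul a b :=
      S.cocycle_bijective.1 (hu.trans (hdot a b).symm)
    rw [hu']
    exact ((key a b c v hc).1 (h a b c)).symm
  · intro h a b c
    obtain ⟨v, hv⟩ := S.cocycle_bijective.2 ((S.action a).symm (S.cocycle c))
    have hc : S.cocycle c = S.action a (S.cocycle v) := by
      rw [hv, MulEquiv.apply_symm_apply]
    exact (key a b c v hc).2 (h a b _ (hdot a b) _).symm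

theorem sigma_sigmaHat_eq_iff : (∀ x y : X, S.sigma (S.sigmaHat x y) = S.sigma y) ↔
    ∀ x y : X, S.sigma (S.sigma x y) * S.sigma x = S.sigma x * S.sigma y := by
  have hmul : ∀ x y : X, S.sigma x * S.sigma y = S.sigma (S.sigma x y) * S.sigma (S.tau y x) :=
    fun x y => Equiv.ext fun z => S.sigma_sigma x y z
  constructor
  · intro h x y
    rw [hmul x y, ← h (S.sigma x y) (S.tau y x), sigmaHat_tau]
  · intro h u v
    obtain ⟨⟨x, y⟩, hxy⟩ := S.r.surjective (u, v)
    rw [r_apply, Prod.mk.injEq] at hxy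
    obtain ⟨rfl, rfl⟩ := hxy
    rw [sigmaHat_tau]
    exact mul_left_cancel ((h x y).trans (hmul x y))

variable {S}

/-- The antihomomorphism `A(X, r) → Sym(X)` that sends the generator of `x` to `σ_x`. -/
noncomputable def derivedPerm
    (h : ∀ x y : X, S.sigma (S.sigma x y) * S.sigma x = S.sigma x * S.sigma y) :
    S.DerivedGroup →* (Equiv.Perm X)ᵐᵒᵖ :=
  PresentedGroup.toGroup (f := fun x => MulOpposite.op (S.sigma x)) (by
    rintro _ ⟨x, y, rfl⟩
    simp only [map_mul, map_inv, FreeGroup.lift_apply_of, mul_inv_eq_one]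
    rw [← MulOpposite.op_mul, ← MulOpposite.op_mul, h,
      ← S.sigma_sigmaHat_eq_iff.2 h y ((S.sigmaHat y).symm x), Equiv.apply_symm_apply])

theorem derivedPerm_iotaDerived
    (h : ∀ x y : X, S.sigma (S.sigma x y) * S.sigma x = S.sigma x * S.sigma y) (x : X) :
    derivedPerm h (S.iotaDerived x) = MulOpposite.op (S.sigma x) := by
  simp [derivedPerm, iotaDerived]

/-- The assumption extends from the generators to all of `G(X, r)`: conjugation by the permutation
of `g` takes `σ_x` to `σ_{g x}`. -/
theorem sigma_perm_mul
    (h : ∀ x y : X, S.sigma (S.sigma x y) * S.sigma x = S.sigma x * S.sigma y)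
    (g : S.StructureGroup) :
    ∀ x : X, S.sigma (S.perm g x) * S.perm g = S.perm g * S.sigma x := by
  refine S.structure_induction
    (p := fun g => ∀ x, S.sigma (S.perm g x) * S.perm g = S.perm g * S.sigma x)
    (fun x => by simp) (fun g z ih x => ?_) (fun g z ih x => ?_) g
  · rw [map_mul, perm_iota, Equiv.Perm.mul_apply, ← mul_assoc, ih, mul_assoc, h, mul_assoc]
  · obtain ⟨y, rfl⟩ := (S.sigma z).surjective x
    have hy : (S.sigma z)⁻¹ (S.sigma z y) = y := (S.sigma z).symm_apply_apply y
    rw [map_mul, map_inv, perm_iota, Equiv.Perm.mul_apply, hy, ← mul_assoc, ih, mul_assoc,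
      mul_assoc, mul_right_inj, mul_inv_eq_iff_eq_mul, mul_assoc, h, inv_mul_cancel_left]

/-- The antihomomorphism of `derivedPerm`, composed with the canonical bijection, is the permutation
action of `G(X, r)`; in particular that action is antimultiplicative for the additive group. -/
theorem derivedPerm_cocycle
    (h : ∀ x y : X, S.sigma (S.sigma x y) * S.sigma x = S.sigma x * S.sigma y)
    (g : S.StructureGroup) : derivedPerm h (S.cocycle g) = MulOpposite.op (S.perm g) := by
  have step : ∀ (g : S.StructureGroup) (x : X), derivedPerm h (S.cocycle (g * S.iota x)) =
      derivedPerm h (S.cocycle g) * MulOpposite.op (S.sigma (S.perm g x)) := by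
    intro g x
    rw [cocycle_mul, cocycle_iota, action_iotaDerived, map_mul, derivedPerm_iotaDerived]
  have step' : ∀ (g : S.StructureGroup) (x : X), MulOpposite.op (S.perm (g * S.iota x)) =
      MulOpposite.op (S.perm g) * MulOpposite.op (S.sigma (S.perm g x)) := by
    intro g x
    rw [← MulOpposite.op_mul, sigma_perm_mul h, map_mul, perm_iota]
  refine S.structure_induction
    (p := fun g => derivedPerm h (S.cocycle g) = MulOpposite.op (S.perm g))
    (by simp [cocycle]) (fun g x ih => ?_) (fun g x ih => ?_) g
  · rw [step, step', ih]
  · have h1 := step (g * (S.iota x)⁻¹) x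
    have h2 := step' (g * (S.iota x)⁻¹) x
    rw [inv_mul_cancel_right] at h1 h2
    exact mul_right_cancel (h1.symm.trans (ih.trans h2))

variable (S)

/-- The permutation action on `X` determines the action on `A(X, r)`, because `X` generates
`A(X, r)`. -/
theorem action_eq_of_perm_eq_mul {g h k : S.StructureGroup} (hp : S.perm g = S.perm h * S.perm k)
    (t : S.DerivedGroup) : S.action g t = S.action h (S.action k t) := by
  have e : (S.action g).toMonoidHom = (S.action h * S.action k).toMonoidHom := by
    refine PresentedGroup.ext fun z => ?_
    change S.action g (S.iotaDerived z) = S.action h (S.action k (S.iotaDerived z))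
    rw [action_iotaDerived, action_iotaDerived, action_iotaDerived, hp, Equiv.Perm.mul_apply]
  exact DFunLike.congr_fun e t

theorem structureSkewBrace_isBiSkew_of_sigma_sigmaHat
    (h : ∀ x y : X, S.sigma (S.sigmaHat x y) = S.sigma y) : S.structureSkewBrace.IsBiSkew := by
  rw [sigma_sigmaHat_eq_iff] at h
  refine S.structureSkewBrace_isBiSkew_iff.2 fun a b u hu => S.action_eq_of_perm_eq_mul ?_
  apply MulOpposite.op_injective
  rw [MulOpposite.op_mul, ← derivedPerm_cocycle h, hu, map_mul, derivedPerm_cocycle,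
    derivedPerm_cocycle]

theorem sigma_sigmaHat_of_structureSkewBrace_isBiSkew (hinj : S.IsInjective)
    (hB : S.structureSkewBrace.IsBiSkew) : ∀ x y : X, S.sigma (S.sigmaHat x y) = S.sigma y := by
  have hinj' : Function.Injective S.iotaDerived := by
    intro x y hxy
    rw [← cocycle_iota, ← cocycle_iota] at hxy
    exact hinj (S.cocycle_bijective.1 hxy)
  refine S.sigma_sigmaHat_eq_iff.2 fun x y => Equiv.ext fun z => ?_
  have hu : S.cocycle (S.iota x * S.iota y) =
      S.cocycle (S.iota x) * S.cocycle (S.iota (S.sigma x y)) := by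
    rw [cocycle_mul, cocycle_iota, cocycle_iota, cocycle_iota, action_iota]
  have h := S.structureSkewBrace_isBiSkew_iff.1 hB _ _ _ hu (S.iotaDerived z)
  simp only [action_mul, action_iota] at h
  exact (hinj' h).symm

end YBSolution

theorem mainTheorem10 {X : Type*} (S : YBSolution X) :
    (S.IsInjective →
      (S.structureSkewBrace.IsBiSkew ↔ ∀ x y : X, S.sigma (S.sigmaHat x y) = S.sigma y)) ∧
    ((∀ x y : X, S.sigma (S.sigmaHat x y) = S.sigma y) → S.structureSkewBrace.IsBiSkew) :=
  ⟨fun hinj => ⟨S.sigma_sigmaHat_of_structureSkewBrace_isBiSkew hinj,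
    S.structureSkewBrace_isBiSkew_of_sigma_sigmaHat⟩,
    S.structureSkewBrace_isBiSkew_of_sigma_sigmaHat⟩
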